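/- Call a set $\mathfrak{d}$ of positive integers uniformly log-discrete if there is $\delta>0$ with $|\log d-\log d'|>\delta$ for all distinct $d,d'\in\mathfrak{d}$. Let $h=\log H$, where $H$ is the absolute multiplicative Weil height on $\mathbb{P}^1(\overline{\mathbb{Q}})$, and let $\eta\in\mathrm{Pic}(\mathbb{P}^1)\otimes\mathbb{R}$ be the class of $\mathcal{O}(1)$. Call a set $S$ of endomorphisms of $\mathbb{P}^1$ over $\overline{\mathbb{Q}}$ height controlled and uniformly log-discrete if there are real numbers $d_\phi>1$ $(\phi\in S)$ with $\phi^*\eta=d_\phi\eta$ for all $\phi\in S$ such that $$\sup_{\phi\in S}\ \sup_{P\in\mathbb{P}^1(\overline{\mathbb{Q}})}\big|h(\phi(P))-d_\phi h(P)\big|<\infty ,$$ and there is $\delta>0$ with $|\log d_\phi-\log d_\psi|>\delta$ for all distinct $\phi,\psi\in S$. Let $M_S$ denote the monoid generated by $S$ and the identity under composition. Let $\mathfrak{d}$ be a uniformly log-discrete set of positive integers, let $c\in\overline{\mathbb{Q}}$ with $c\neq 0$, and let $$S=S_{\mathfrak{d},c}=\{z^d+c\,:\,d\in\mathfrak{d},\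 d\geq2\}.$$ Then: 1. $S$ is height controlled and uniformly log-discrete. 2. $M_S$ is free on $S$: distinct finite words in $S$ give distinct compositions. 3. If $S$ has at least two elements (so that $M_S$ is a non-abelian free monoid), then there is a constant $B_S$, depending only on $S$, such that for every $\epsilon>0$ there is $b=b(S,\epsilon)>0$ with the following property: for every $P\in\mathbb{P}^1(\overline{\mathbb{Q}})$ with $H(P)>B_S$ there are constants $c_1,c_2>0$ (depending on $P$, $S$ and $\epsilon$) such that for all sufficiently large $B$ the set $\{f\in M_S: H(f(P))\leq B\}$ is finite and $$c_1(\log B)^{b}\ \leq\ \#\{f\in M_S\,:\,H(f(P))\leq B\}\ \leq\ c_2(\log B)^{b+\epsilon}.$$ -/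

import Mathlib

open scoped LinearAlgebra.Projectivization

noncomputable section

namespace OrbitCount

/-! ### The projective line and its endomorphisms -/

/-- The closed points of the projective line over `k`. -/
abbrev P1 (k : Type*) [Field k] : Type _ := ℙ k (Fin 2 → k)

/-- The point `[t : 1]`. -/
def affinePt {k : Type*} [Field k] (t : k) : P1 k :=
  Projectivization.mk k ![t, 1] (by simp)

/-- The point at infinity `[1 : 0]`. -/
def inftyPt (k : Type*) [Field k] : P1 k :=
  Projectivization.mk k ![1, 0] (by simp)

/-- A pair of binary forms of the same degree without a common zero. Over an algebraically
closed field these are exactly the data that give endomorphisms of the projective line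
(two pairs give the same endomorphism if and only if they are proportional). -/
structure FormPair (k : Type*) [Field k] where
  deg : ℕ
  form : Fin 2 → MvPolynomial (Fin 2) k
  homogeneous : ∀ i, (form i).IsHomogeneous deg
  no_common_zero : ∀ v : Fin 2 → k, (∀ i, MvPolynomial.eval v (form i) = 0) → v = 0

theorem FormPair.eval_ne_zero {k : Type*} [Field k] (p : FormPair k) {v : Fin 2 → k}
    (hv : v ≠ 0) : (fun i => MvPolynomial.eval v (p.form i)) ≠ 0 :=
  fun h => hv (p.no_common_zero v (congrFun h))

theorem eval_smul_of_isHomogeneous {k : Type*} [Field k] {n : ℕ} {F : MvPolynomial (Fin 2) k}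
    (hF : F.IsHomogeneous n) (t : k) (v : Fin 2 → k) :
    MvPolynomial.eval (t • v) F = t ^ n * MvPolynomial.eval v F := by
  rw [MvPolynomial.eval_eq, MvPolynomial.eval_eq, Finset.mul_sum]
  refine Finset.sum_congr rfl fun m hm => ?_
  have h : n = ∑ i ∈ m.support, m i := hF.degree_eq_sum_deg_support hm
  simp only [Pi.smul_apply, smul_eq_mul, mul_pow, Finset.prod_mul_distrib]
  rw [Finset.prod_pow_eq_pow_sum, ← h]
  ring

/-- The endomorphism `[x : y] ↦ [F₀(x, y) : F₁(x, y)]` of the projective line, as a map on closed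
points. `Function.End` is the monoid of self-maps under composition. -/
def FormPair.toEnd {k : Type*} [Field k] (p : FormPair k) : Function.End (P1 k) :=
  fun P => Projectivization.lift
    (fun v : {v : Fin 2 → k // v ≠ 0} =>
      Projectivization.mk k (fun i => MvPolynomial.eval v.1 (p.form i)) (p.eval_ne_zero v.2))
    (by
      rintro ⟨v, hv⟩ ⟨w, hw⟩ t h
      change v = t • w at h
      subst h
      rw [Projectivization.mk_eq_mk_iff']
      exact ⟨t ^ p.deg, funext fun i => (eval_smul_of_isHomogeneous (p.homogeneous i) t w).symm⟩) P

/-- The forms `(X ^ d + c Y ^ d, Y ^ d)`. -/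
def unicriticalForms {k : Type*} [Field k] (d : ℕ) (c : k) : FormPair k where
  deg := d
  form := ![MvPolynomial.X 0 ^ d + MvPolynomial.C c * MvPolynomial.X 1 ^ d, MvPolynomial.X 1 ^ d]
  homogeneous := by
    intro i
    fin_cases i
    · exact (MvPolynomial.isHomogeneous_X_pow 0 d).add
        (MvPolynomial.isHomogeneous_C_mul_X_pow c 1 d)
    · exact MvPolynomial.isHomogeneous_X_pow 1 d
  no_common_zero := by
    intro v h
    have h1 : v 1 ^ d = 0 := by simpa using h 1
    have h0 : v 0 ^ d = 0 := by simpa [h1] using h 0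
    funext i
    fin_cases i
    · exact eq_zero_of_pow_eq_zero h0
    · exact eq_zero_of_pow_eq_zero h1

/-- The polynomial map `z ↦ z ^ d + c`, extended to the projective line. -/
def unicritical {k : Type*} [Field k] (d : ℕ) (c : k) : Function.End (P1 k) :=
  (unicriticalForms d c).toEnd

/-! ### Divisor classes on the projective line and their pullbacks -/

/-- Divisors on the projective line with real coefficients. -/
abbrev Div (k : Type*) [Field k] : Type _ := P1 k →₀ ℝ

/-- The divisor of zeros of a one-variable polynomial on the affine line. -/
def zerosDiv {k : Type*} [Field k] (g : Polynomial k) : Div k :=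
  (g.roots.map fun t => Finsupp.single (affinePt t) (1 : ℝ)).sum

/-- The divisor of zeros and poles of a rational function (over an algebraically closed field);
its order at infinity is minus its degree. -/
def ratFuncDiv {k : Type*} [Field k] (f : RatFunc k) : Div k :=
  zerosDiv f.num - zerosDiv f.denom - Finsupp.single (inftyPt k) (f.intDegree : ℝ)

/-- The real span of the principal divisors. -/
def principal (k : Type*) [Field k] : Submodule ℝ (Div k) :=
  Submodule.span ℝ {D | ∃ f : RatFunc k, f ≠ 0 ∧ D = ratFuncDiv f}

/-- The group `Pic(ℙ¹) ⊗ ℝ` (for `k` algebraically closed): real divisors modulo the real span of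
the principal divisors. -/
abbrev PicR (k : Type*) [Field k] : Type _ := Div k ⧸ principal k

/-- The class of a divisor. -/
def divClass {k : Type*} [Field k] (D : Div k) : PicR k := (principal k).mkQ D

/-- The divisor of zeros of a binary form `L` of degree `n`: the zeros `[t : 1]` are the roots
of `L(z, 1)`, and the multiplicity of `[1 : 0]` is the drop in degree of `L(z, 1)`. -/
def formDiv {k : Type*} [Field k] (n : ℕ) (L : MvPolynomial (Fin 2) k) : Div k :=
  zerosDiv (MvPolynomial.aeval ![(Polynomial.X : Polynomial k), 1] L) +
    Finsupp.single (inftyPt k)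
      ((n : ℝ) - (MvPolynomial.aeval ![(Polynomial.X : Polynomial k), 1] L).natDegree)

/-- The pullback of the point `Q = [a : b]`: the zeros of `b F₀ - a F₁`, that is, the fibre over
`Q` counted with ramification indices. -/
def FormPair.fiber {k : Type*} [Field k] (p : FormPair k) (Q : P1 k) : Div k :=
  formDiv p.deg
    (MvPolynomial.C (Q.rep 1) * p.form 0 - MvPolynomial.C (Q.rep 0) * p.form 1)

/-- The pullback of divisors. -/
def FormPair.pullback {k : Type*} [Field k] (p : FormPair k) (D : Div k) : Div k :=
  D.sum fun Q a => a • p.fiber Q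

/-- `φ` is an endomorphism of the projective line with `φ^* η = η'`. The class of the pullback of
a divisor depends only on its class, so any representative of `η` can be used. -/
def IsPullback {k : Type*} [Field k] (φ : Function.End (P1 k)) (η η' : PicR k) : Prop :=
  ∃ p : FormPair k, p.toEnd = φ ∧ ∃ D : Div k, divClass D = η ∧ divClass (p.pullback D) = η'

/-- The class of a point, i.e. of `𝒪(1)`. -/
def hyperplaneClass (k : Type*) [Field k] : PicR k :=
  divClass (Finsupp.single (inftyPt k) 1)

/-! ### Heights -/

/-- The field of algebraic numbers. -/
abbrev Qbar : Type := AlgebraicClosure ℚ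

open Classical in
/-- The absolute multiplicative Weil height on the algebraic points of the projective line,
a height associated to `𝒪(1)`: `H([t : 1])` is the absolute height of `t`, and `H([1 : 0]) = 1`. -/
def mulHeight (P : P1 Qbar) : ℝ :=
  if P.rep 1 = 0 then 1 else NumberField.absMulHeight₁ (P.rep 0 / P.rep 1)

/-- The absolute logarithmic Weil height. -/
def logHeight (P : P1 Qbar) : ℝ := Real.log (mulHeight P)

/-! ### Height controlled and uniformly log-discrete sets -/

/-- `S` is height controlled with respect to `𝒪(1)`, with eigenvalues `d φ`: each `φ ∈ S` is an
endomorphism with `φ^* η = d φ • η` and `d φ > 1`, and the differences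
`|h(φ(P)) - d φ * h(P)|` are bounded uniformly in `P` and in `φ ∈ S`. -/
def HeightControlledWith (S : Set (Function.End (P1 Qbar)))
    (d : Function.End (P1 Qbar) → ℝ) : Prop :=
  (∀ φ ∈ S, 1 < d φ ∧ IsPullback φ (hyperplaneClass Qbar) (d φ • hyperplaneClass Qbar)) ∧
    ∃ C : ℝ, ∀ φ ∈ S, ∀ P : P1 Qbar, |logHeight (φ P) - d φ * logHeight P| ≤ C

/-- `S` is height controlled and uniformly log-discrete with respect to `𝒪(1)`. -/
def HeightControlledLogDiscrete (S : Set (Function.End (P1 Qbar))) : Prop :=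
  ∃ d : Function.End (P1 Qbar) → ℝ, HeightControlledWith S d ∧
    ∃ δ : ℝ, 0 < δ ∧ ∀ φ ∈ S, ∀ ψ ∈ S, φ ≠ ψ → δ < |Real.log (d φ) - Real.log (d ψ)|

/-- A set of positive integers is uniformly log-discrete. -/
def UniformlyLogDiscrete (𝔡 : Set ℕ) : Prop :=
  ∃ δ : ℝ, 0 < δ ∧ ∀ d ∈ 𝔡, ∀ d' ∈ 𝔡, d ≠ d' → δ < |Real.log (d : ℝ) - Real.log (d' : ℝ)|

/-! ### Generated monoids and the function count -/

/-- The monoid `M_S` generated by `S` (and the identity) under composition. -/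
def genMonoid (S : Set (Function.End (P1 Qbar))) : Submonoid (Function.End (P1 Qbar)) :=
  Submonoid.closure S

/-- The monoid generated by `S` is free on `S`: distinct finite words in `S` give distinct
compositions. -/
def GeneratesFreely (S : Set (Function.End (P1 Qbar))) : Prop :=
  Function.Injective (FreeMonoid.lift fun φ : S => (φ : Function.End (P1 Qbar)))

/-- The two-sided bound `(log B)^b ≪ #{f ∈ M_S : H(f(P)) ≤ B} ≪ (log B)^(b + ε)` as `B → ∞`, for
all `P` of large height. The height threshold depends only on `S`, the exponent only on
`S` and `ε`, and the implied constants on `S`, `ε` and `P`. -/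
def FunctionCount (S : Set (Function.End (P1 Qbar))) : Prop :=
  ∃ B₀ : ℝ, ∀ ε : ℝ, 0 < ε → ∃ b : ℝ, 0 < b ∧
    ∀ P : P1 Qbar, B₀ < mulHeight P →
      ∃ c₁ c₂ : ℝ, 0 < c₁ ∧ 0 < c₂ ∧ ∀ᶠ B : ℝ in Filter.atTop,
        {f | f ∈ genMonoid S ∧ mulHeight (f P) ≤ B}.Finite ∧
        c₁ * Real.log B ^ b ≤ ({f | f ∈ genMonoid S ∧ mulHeight (f P) ≤ B}.ncard : ℝ) ∧
        ({f | f ∈ genMonoid S ∧ mulHeight (f P) ≤ B}.ncard : ℝ) ≤ c₂ * Real.log B ^ (b + ε)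

/-- The set `{z ^ d + c : d ∈ 𝔡, d ≥ 2}`. -/
def unicriticalSet (𝔡 : Set ℕ) (c : Qbar) : Set (Function.End (P1 Qbar)) :=
  {φ | ∃ d ∈ 𝔡, 2 ≤ d ∧ φ = unicritical d c}

end OrbitCount

end

noncomputable section

namespace OrbitCount

/-! ### Heights in extensions of number fields -/

section Extension

open NumberField Height Module

variable {K L : Type*} [Field K] [NumberField K] [Field L] [NumberField L]

/-! Powers scale the height exactly, `h(z ^ d) = d h(z)`, and adding `c` moves it by at most `A =
log 2 + h(c)`, whatever `d` is. This gives height control. Iterating, a word `f` with product of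
degrees `n` satisfies `|h(f P) - n h(P)| ≤ A (n - 1)`, so for `h(P) > A` the condition `H(f P) ≤ B`
lies between `n ≤ log B / (h(P) + A)` and `n ≤ log B / (h(P) - A)`.

Freeness turns functions into words. Comparing outermost letters leads to `g ^ a = h ^ b`; if `a <
b`, every zero of `g` is multiple, so `g ∣ g' ^ 2`. No composition has this property, because `c ≠
0` makes `u ^ e + c` coprime to `u` (`dvd_derivative_sq_of_pow_eq_pow`,
`not_dvd_derivative_sq_of_pow_add_C`).

The number `N(x)` of words with product at most `x` obeys `N(x) = 1 + ∑ N(x / d)` for `x ≥ 1`. Hence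
`N(x) ≪ x ^ s` if all finite sums of `d ^ (-s)` stay below some `q < 1`, and `N(x) ≫ x ^ s` if one
finite sum reaches `1`. An exponent `b` just below the threshold between the two gives both bounds
(`exists_exponent`). -/

theorem prod_infinitePlace_pow_mult_eq_prod_embeddings {M : Type*} [CommMonoid M]
    (f : InfinitePlace K → M) :
    ∏ v : InfinitePlace K, f v ^ v.mult = ∏ φ : K →+* ℂ, f (InfinitePlace.mk φ) := by
  classical
  rw [← Finset.prod_fiberwise Finset.univ InfinitePlace.mk (fun φ => f (InfinitePlace.mk φ))]
  refine Finset.prod_congr rfl fun v _ => ?_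
  rw [← InfinitePlace.card_filter_mk_eq v, ← Finset.prod_const]
  refine Finset.prod_congr rfl fun φ hφ => ?_
  rw [(Finset.mem_filter.mp hφ).2]

theorem card_embeddings_lying_over [Algebra K L] (φ : K →+* ℂ) :
    Nat.card {ψ : L →+* ℂ // ψ.comp (algebraMap K L) = φ} = finrank K L := by
  let _ : Algebra K ℂ := φ.toAlgebra
  rw [← AlgHom.card K L ℂ, ← Nat.card_eq_fintype_card]
  exact Nat.card_congr
    { toFun := fun ψ => { ψ.1 with commutes' := fun r => RingHom.congr_fun ψ.2 r }
      invFun := fun σ => ⟨σ.toRingHom, RingHom.ext fun r => σ.commutes r⟩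
      left_inv := fun _ => rfl
      right_inv := fun _ => rfl }

theorem prod_embeddings_comp_algebraMap [Algebra K L] {M : Type*} [CommMonoid M]
    (f : (K →+* ℂ) → M) :
    ∏ ψ : L →+* ℂ, f (ψ.comp (algebraMap K L)) = (∏ φ : K →+* ℂ, f φ) ^ finrank K L := by
  classical
  rw [← Finset.prod_fiberwise Finset.univ (fun ψ : L →+* ℂ => ψ.comp (algebraMap K L)),
    ← Finset.prod_pow]
  refine Finset.prod_congr rfl fun φ _ => ?_
  rw [← card_embeddings_lying_over (L := L) φ, Nat.card_eq_fintype_card, Fintype.card_subtype,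
    ← Finset.prod_const]
  refine Finset.prod_congr rfl fun ψ hψ => ?_
  rw [(Finset.mem_filter.mp hψ).2]

/-- For integral coordinates the finite places contribute the inverse norm of the ideal they
generate. Both the norm and the product over embeddings behave simply under field extension. -/
theorem absNorm_mul_mulHeight_integers {ι : Type*} [Finite ι] {x : ι → 𝓞 K} (hx : x ≠ 0) :
    (Ideal.span (Set.range x)).absNorm * Height.mulHeight (fun i => (x i : K)) =
      ∏ φ : K →+* ℂ, ⨆ i, ‖φ (x i)‖ := by
  have hx' : (fun i => (x i : K)) ≠ 0 := fun h =>
    hx (funext fun i => RingOfIntegers.ext (by simpa using congrFun h i))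
  rw [NumberField.mulHeight_eq hx', mul_left_comm, absNorm_mul_finprod_finitePlace_eq_one hx,
    mul_one, prod_infinitePlace_pow_mult_eq_prod_embeddings (fun v => ⨆ i, v (x i : K))]
  rfl

theorem mulHeight_algebraMap_integers [Algebra K L] {ι : Type*} [Finite ι] {x : ι → 𝓞 K}
    (hx : x ≠ 0) :
    Height.mulHeight (fun i => algebraMap K L (x i)) =
      Height.mulHeight (fun i => (x i : K)) ^ finrank K L := by
  have hinj : Function.Injective (algebraMap (𝓞 K) (𝓞 L)) :=
    FaithfulSMul.algebraMap_injective _ _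
  have hy : (fun i => algebraMap (𝓞 K) (𝓞 L) (x i)) ≠ 0 := fun h =>
    hx (funext fun i => hinj (by simpa using congrFun h i))
  have hspan : Ideal.span (Set.range fun i => algebraMap (𝓞 K) (𝓞 L) (x i)) =
      (Ideal.span (Set.range x)).map (algebraMap (𝓞 K) (𝓞 L)) := by
    rw [Ideal.map_span, ← Set.range_comp]
    rfl
  have h1 := absNorm_mul_mulHeight_integers hy
  have h2 := absNorm_mul_mulHeight_integers hx
  have hprod := prod_embeddings_comp_algebraMap (L := L) (fun φ : K →+* ℂ => ⨆ i, ‖φ (x i)‖)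
  rw [← h2] at hprod
  have hne : ((Ideal.span (Set.range x)).absNorm : ℝ) ≠ 0 := by
    rw [Nat.cast_ne_zero, Ne, Ideal.absNorm_eq_zero_iff, Ideal.span_eq_bot]
    intro h
    exact hx (funext fun i => h _ ⟨i, rfl⟩)
  have hfr : finrank (𝓞 K) (𝓞 L) = finrank K L :=
    (IsFractionRing.finrank_eq (𝓞 K) K (𝓞 L) L).symm
  rw [hspan, Ideal.absNorm_algebraMap, hfr] at h1
  have h3 := h1.trans hprod
  rw [mul_pow, Nat.cast_pow] at h3
  exact mul_left_cancel₀ (pow_ne_zero _ hne) h3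

/-- The relative height of `x` in an extension `L / K` is the `[L : K]`-th power of its height
in `K`. -/
theorem mulHeight₁_algebraMap [Algebra K L] (x : K) :
    mulHeight₁ (algebraMap K L x) = mulHeight₁ x ^ finrank K L := by
  obtain ⟨a, b, hb, rfl⟩ := IsFractionRing.div_surjective (A := 𝓞 K) x
  have hb0 : b ≠ 0 := nonZeroDivisors.ne_zero hb
  have h := mulHeight_algebraMap_integers (L := L) (x := ![a, b])
    (fun h => hb0 (by simpa using congrFun h 1))
  have hL : (fun i => algebraMap K L (![a, b] i)) =
      ![algebraMap K L (algebraMap (𝓞 K) K a), algebraMap K L (algebraMap (𝓞 K) K b)] := by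
    ext i; fin_cases i <;> rfl
  have hK : (fun i => (![a, b] i : K)) = ![algebraMap (𝓞 K) K a, algebraMap (𝓞 K) K b] := by
    ext i; fin_cases i <;> rfl
  rwa [hL, hK, ← mulHeight₁_div_eq_mulHeight, ← mulHeight₁_div_eq_mulHeight, ← map_div₀] at h

end Extension

/-! ### Absolute heights -/

section Absolute

open NumberField Height Module IntermediateField

variable {E : Type*} [Field E] [CharZero E]

/-- The absolute height can be computed in any number field containing the element. -/
theorem absMulHeight₁_coe (F : IntermediateField ℚ E) [NumberField F] (x : F) :
    absMulHeight₁ (x : E) = mulHeight₁ x ^ ((finrank ℚ F : ℝ)⁻¹) := by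
  have hx : IsIntegral ℚ (x : E) :=
    (Algebra.IsIntegral.isIntegral (R := ℚ) x).map F.val
  have : FiniteDimensional ℚ ℚ⟮(x : E)⟯ := adjoin.finiteDimensional hx
  have : NumberField ℚ⟮(x : E)⟯ := {}
  have hle : ℚ⟮(x : E)⟯ ≤ F := by simp
  let _ : Algebra ℚ⟮(x : E)⟯ F := (inclusion hle).toRingHom.toAlgebra
  have hmap : algebraMap ℚ⟮(x : E)⟯ F (AdjoinSimple.gen ℚ (x : E)) = x := rfl
  rw [absMulHeight₁, dif_pos hx]
  conv_rhs => rw [← hmap, mulHeight₁_algebraMap]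
  rw [← finrank_mul_finrank ℚ ℚ⟮(x : E)⟯ F, ← Real.rpow_natCast, ← Real.rpow_mul (by positivity)]
  congr 1
  have : (finrank ℚ⟮(x : E)⟯ F : ℝ) ≠ 0 := by
    have : 0 < finrank ℚ⟮(x : E)⟯ F := finrank_pos
    positivity
  push_cast
  rw [mul_inv, mul_left_comm, mul_inv_cancel₀ this, mul_one]

end Absolute

section Absolute

open NumberField Height Module IntermediateField

variable {E : Type*} [Field E] [CharZero E]

theorem absLogHeight₁_coe (F : IntermediateField ℚ E) [NumberField F] (x : F) :
    absLogHeight₁ (x : E) = logHeight₁ x / finrank ℚ F := by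
  rw [absLogHeight₁, absMulHeight₁_coe, Real.log_rpow (mulHeight₁_pos x), div_eq_inv_mul]
  rfl

variable [Algebra.IsAlgebraic ℚ E]

theorem exists_numberField_mem_mem (x y : E) :
    ∃ F : IntermediateField ℚ E, NumberField F ∧ x ∈ F ∧ y ∈ F := by
  have hfin : FiniteDimensional ℚ (adjoin ℚ {x, y}) :=
    finiteDimensional_adjoin fun z _ => Algebra.IsIntegral.isIntegral z
  exact ⟨adjoin ℚ {x, y}, {}, subset_adjoin _ _ (by simp), subset_adjoin _ _ (by simp)⟩

theorem one_le_absMulHeight₁ (x : E) : 1 ≤ absMulHeight₁ x := by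
  obtain ⟨F, hF, hx, -⟩ := exists_numberField_mem_mem x x
  rw [show x = ((⟨x, hx⟩ : F) : E) from rfl, absMulHeight₁_coe]
  exact Real.one_le_rpow (one_le_mulHeight₁ _) (by positivity)

theorem absLogHeight₁_pow (x : E) (n : ℕ) : absLogHeight₁ (x ^ n) = n * absLogHeight₁ x := by
  obtain ⟨F, hF, hx, -⟩ := exists_numberField_mem_mem x x
  lift x to F using hx
  rw [← SubmonoidClass.coe_pow, absLogHeight₁_coe, absLogHeight₁_coe, logHeight₁_pow, mul_div_assoc]

theorem absLogHeight₁_neg (x : E) : absLogHeight₁ (-x) = absLogHeight₁ x := by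
  obtain ⟨F, hF, hx, -⟩ := exists_numberField_mem_mem x x
  lift x to F using hx
  rw [← NegMemClass.coe_neg, absLogHeight₁_coe, absLogHeight₁_coe, logHeight₁_neg]

theorem absLogHeight₁_add_le (x y : E) :
    absLogHeight₁ (x + y) ≤ Real.log 2 + absLogHeight₁ x + absLogHeight₁ y := by
  obtain ⟨F, hF, hx, hy⟩ := exists_numberField_mem_mem x y
  lift x to F using hx
  lift y to F using hy
  have hpos : (0 : ℝ) < finrank ℚ F := by exact_mod_cast finrank_pos
  rw [← AddMemClass.coe_add, absLogHeight₁_coe, absLogHeight₁_coe, absLogHeight₁_coe,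
    div_le_iff₀ hpos, add_mul, add_mul, div_mul_cancel₀ _ hpos.ne', div_mul_cancel₀ _ hpos.ne']
  have h := logHeight₁_add_le x y
  -- The relative constant is `[F : ℚ] log 2`, so normalising leaves `log 2`, independent of `F`.
  rw [totalWeight_eq_finrank] at h
  linarith

/-- Translation by `c` changes the height by a bounded amount. -/
theorem abs_absLogHeight₁_add_sub_le (x c : E) :
    |absLogHeight₁ (x + c) - absLogHeight₁ x| ≤ Real.log 2 + absLogHeight₁ c := by
  have h1 := absLogHeight₁_add_le x c
  have h2 := absLogHeight₁_add_le (x + c) (-c)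
  rw [add_neg_cancel_right, absLogHeight₁_neg] at h2
  rw [abs_le]
  constructor <;> linarith

end Absolute

/-! ### Unicritical maps on points -/

section Points

variable {k : Type*} [Field k]

theorem eq_inftyPt_or_exists_affinePt (P : P1 k) : P = inftyPt k ∨ ∃ t, P = affinePt t := by
  induction P using Projectivization.ind with
  | h v hv =>
    by_cases h1 : v 1 = 0
    · left
      rw [inftyPt, Projectivization.mk_eq_mk_iff']
      refine ⟨v 0, ?_⟩
      ext i; fin_cases i <;> simp [h1]
    · right
      refine ⟨v 0 / v 1, ?_⟩
      rw [affinePt, Projectivization.mk_eq_mk_iff']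
      refine ⟨v 1, ?_⟩
      ext i; fin_cases i <;> simp [h1, mul_div_cancel₀]

theorem affinePt_injective : Function.Injective (affinePt : k → P1 k) := by
  intro s t h
  rw [affinePt, affinePt, Projectivization.mk_eq_mk_iff'] at h
  obtain ⟨a, ha⟩ := h
  have h1 : a = 1 := by simpa using congrFun ha 1
  simpa [h1] using (congrFun ha 0).symm

theorem unicritical_affinePt (d : ℕ) (c t : k) :
    unicritical d c (affinePt t) = affinePt (t ^ d + c) := by
  change Projectivization.mk k _ _ = Projectivization.mk k _ _
  congr 1
  ext i; fin_cases i <;> simp [unicriticalForms]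

theorem unicritical_inftyPt {d : ℕ} (hd : d ≠ 0) (c : k) :
    unicritical d c (inftyPt k) = inftyPt k := by
  change Projectivization.mk k _ _ = Projectivization.mk k _ _
  congr 1
  ext i; fin_cases i <;> simp [unicriticalForms, hd]

theorem inftyPt_rep : ∃ a : k, a ≠ 0 ∧ (inftyPt k).rep = ![a, 0] := by
  obtain ⟨a, ha⟩ := Projectivization.exists_smul_eq_mk_rep k ![(1 : k), 0] (by simp)
  refine ⟨a, a.ne_zero, ?_⟩
  rw [inftyPt, ← ha]
  ext i; fin_cases i <;> simp [Units.smul_def]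

theorem affinePt_rep (t : k) : ∃ a : k, a ≠ 0 ∧ (affinePt t).rep = ![a * t, a] := by
  obtain ⟨a, ha⟩ := Projectivization.exists_smul_eq_mk_rep k ![t, 1] (by simp)
  refine ⟨a, a.ne_zero, ?_⟩
  rw [affinePt, ← ha]
  ext i; fin_cases i <;> simp [Units.smul_def]

/-- The pullback of `𝒪(1)` along `z ^ d + c` is `𝒪(d)`. -/
theorem isPullback_unicritical {d : ℕ} (c : k) :
    IsPullback (unicritical d c) (hyperplaneClass k) ((d : ℝ) • hyperplaneClass k) := by
  refine ⟨unicriticalForms d c, rfl, Finsupp.single (inftyPt k) 1, rfl, ?_⟩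
  obtain ⟨a, -, ha⟩ := inftyPt_rep (k := k)
  -- The fibre over infinity is cut out by `-a Y ^ d`, a constant on the affine line, so all `d`
  -- zeros lie at infinity.
  have hform : MvPolynomial.aeval ![(Polynomial.X : Polynomial k), 1]
      (MvPolynomial.C ((inftyPt k).rep 1) * (unicriticalForms d c).form 0 -
        MvPolynomial.C ((inftyPt k).rep 0) * (unicriticalForms d c).form 1) =
      Polynomial.C (-a) := by
    simp [ha, unicriticalForms, Polynomial.algebraMap_eq]
  have hfiber : (unicriticalForms d c).fiber (inftyPt k) =
      (d : ℝ) • Finsupp.single (inftyPt k) (1 : ℝ) := by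
    rw [FormPair.fiber, formDiv, hform, zerosDiv, Polynomial.roots_C, Polynomial.natDegree_C]
    simp [unicriticalForms]
  rw [FormPair.pullback, Finsupp.sum_single_index (by simp), one_smul, hfiber]
  exact map_smul _ _ _

end Points

/-! ### Heights on the projective line -/

instance isAlgebraic_qbar : Algebra.IsAlgebraic ℚ Qbar := by
  convert! AlgebraicClosure.isAlgebraic ℚ

theorem mulHeight_inftyPt : mulHeight (inftyPt Qbar) = 1 := by
  obtain ⟨a, -, h⟩ := inftyPt_rep (k := Qbar)
  simp [mulHeight, h]

theorem mulHeight_affinePt (t : Qbar) : mulHeight (affinePt t) = NumberField.absMulHeight₁ t := by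
  obtain ⟨a, ha, h⟩ := affinePt_rep t
  simp [mulHeight, h, ha]

theorem logHeight_inftyPt : logHeight (inftyPt Qbar) = 0 := by
  rw [logHeight, mulHeight_inftyPt, Real.log_one]

theorem logHeight_affinePt (t : Qbar) : logHeight (affinePt t) = NumberField.absLogHeight₁ t := by
  rw [logHeight, mulHeight_affinePt, NumberField.absLogHeight₁]

theorem one_le_mulHeight (P : P1 Qbar) : 1 ≤ mulHeight P := by
  obtain rfl | ⟨t, rfl⟩ := eq_inftyPt_or_exists_affinePt P
  · rw [mulHeight_inftyPt]
  · rw [mulHeight_affinePt]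
    exact one_le_absMulHeight₁ t

theorem abs_logHeight_unicritical_sub_le {d : ℕ} (hd : d ≠ 0) (c : Qbar) (P : P1 Qbar) :
    |logHeight (unicritical d c P) - d * logHeight P| ≤
      Real.log 2 + NumberField.absLogHeight₁ c := by
  obtain rfl | ⟨t, rfl⟩ := eq_inftyPt_or_exists_affinePt P
  · rw [unicritical_inftyPt hd, logHeight_inftyPt, mul_zero, sub_zero, abs_zero]
    have := Real.log_nonneg (one_le_absMulHeight₁ c)
    rw [NumberField.absLogHeight₁]
    positivity
  · rw [unicritical_affinePt, logHeight_affinePt, logHeight_affinePt, ← absLogHeight₁_pow]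
    exact abs_absLogHeight₁_add_sub_le _ _

/-! ### Compositions of unicritical polynomials -/

section Polynomials

open Polynomial

variable {k : Type*} [Field k]

/-- The polynomial of the composition of the maps `z ^ d + c`, for `d` running through a word. -/
def wordPoly (c : k) : List ℕ → k[X]
  | [] => X
  | d :: w => wordPoly c w ^ d + C c

theorem monic_wordPoly_and_natDegree_pos (c : k) {w : List ℕ} (hw : ∀ d ∈ w, 2 ≤ d) :
    (wordPoly c w).Monic ∧ 0 < (wordPoly c w).natDegree := by
  induction w with
  | nil => exact ⟨monic_X, by simp [wordPoly]⟩
  | cons d w ih =>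
    obtain ⟨hm, hd⟩ := ih fun e he => hw e (List.mem_cons_of_mem _ he)
    have hd2 : 2 ≤ d := hw d (by simp)
    have hpos : 0 < (wordPoly c w ^ d).natDegree := by
      rw [natDegree_pow]
      positivity
    refine ⟨(hm.pow d).add_of_left ?_, ?_⟩
    · exact degree_C_le.trans_lt (natDegree_pos_iff_degree_pos.mp hpos)
    · rwa [wordPoly, natDegree_add_C]

theorem two_le_natDegree_wordPoly_cons (c : k) {d : ℕ} {w : List ℕ}
    (hw : ∀ e ∈ d :: w, 2 ≤ e) : 2 ≤ (wordPoly c (d :: w)).natDegree := by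
  have hpos := (monic_wordPoly_and_natDegree_pos c (w := w)
    fun e he => hw e (List.mem_cons_of_mem _ he)).2
  rw [wordPoly, natDegree_add_C, natDegree_pow]
  exact (hw d (by simp)).trans (Nat.le_mul_of_pos_right d hpos)

variable [CharZero k]

/-- If `g ^ a = h ^ b` with `a < b`, then all zeros of `g` are multiple. -/
theorem dvd_derivative_sq_of_pow_eq_pow {g h : k[X]} {a b : ℕ} (ha : a ≠ 0) (hab : a < b)
    (hg : g ≠ 0) (hpow : g ^ a = h ^ b) : g ∣ derivative g ^ 2 := by
  have hh : h ≠ 0 := by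
    rintro rfl
    rw [zero_pow (by omega)] at hpow
    exact hg (eq_zero_of_pow_eq_zero hpow)
  have hdvd : h ∣ g := by
    rw [← IsIntegrallyClosed.pow_dvd_pow_iff ha, hpow]
    exact pow_dvd_pow h hab.le
  obtain ⟨q, rfl⟩ := hdvd
  -- Logarithmic derivative of `g ^ a = h ^ b`, with denominators cleared and `g = h q`.
  have hlog : (a : k[X]) * derivative (h * q) = (b : k[X]) * derivative h * q := by
    have hder := congrArg derivative hpow
    rw [derivative_pow, derivative_pow] at hder
    simp only [C_eq_natCast] at hder
    have hne : (h * q) ^ a * h ≠ 0 := mul_ne_zero (pow_ne_zero _ hg) hh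
    refine mul_left_cancel₀ hne ?_
    have ha' : (h * q) ^ a = (h * q) ^ (a - 1) * (h * q) := by
      rw [← pow_succ, Nat.sub_add_cancel (by omega)]
    have hb' : h ^ b = h ^ (b - 1) * h := by
      rw [← pow_succ, Nat.sub_add_cancel (by omega)]
    calc (h * q) ^ a * h * ((a : k[X]) * derivative (h * q))
        = ((a : k[X]) * (h * q) ^ (a - 1) * derivative (h * q)) * (h * q) * h := by
          rw [ha']; ring
      _ = ((b : k[X]) * h ^ (b - 1) * derivative h) * (h * q) * h := by rw [hder]
      _ = (h ^ (b - 1) * h) * h * ((b : k[X]) * derivative h * q) := by ring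
      _ = (h * q) ^ a * h * ((b : k[X]) * derivative h * q) := by rw [hpow, hb']
  have hunit : ∀ n : ℕ, n ≠ 0 → IsUnit (n : k[X]) := fun n hn => by
    rw [← C_eq_natCast, isUnit_C]
    exact IsUnit.mk0 _ (Nat.cast_ne_zero.mpr hn)
  -- Expanding `(h q)'` gives `(b - a) h' q = a h q'`, and `b - a` is a unit.
  have hhq : h ∣ derivative h * q := by
    obtain ⟨e, rfl⟩ := Nat.exists_eq_add_of_lt hab
    rw [← (hunit (e + 1) (by omega)).dvd_mul_left]
    refine ⟨a * derivative q, ?_⟩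
    rw [derivative_mul] at hlog
    push_cast at hlog ⊢
    linear_combination -hlog
  rw [← ((hunit a ha).pow 2).dvd_mul_left, ← mul_pow, hlog]
  obtain ⟨r, hr⟩ := hhq
  exact ⟨b ^ 2 * derivative h * r, by linear_combination (b ^ 2 * derivative h * q) * hr⟩

/-- Being coprime to `u`, the polynomial `u ^ e + c` would have to divide `u' ^ 2`, whose degree is
below `2 deg u ≤ e deg u`. -/
theorem not_dvd_derivative_sq_of_pow_add_C {u : k[X]} (hu : 0 < u.natDegree) {e : ℕ} (he : 2 ≤ e)
    {c : k} (hc : c ≠ 0) : ¬ (u ^ e + C c) ∣ derivative (u ^ e + C c) ^ 2 := by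
  intro hdvd
  have hcop : IsCoprime (u ^ e + C c) u := by
    refine ⟨C c⁻¹, -C c⁻¹ * u ^ (e - 1), ?_⟩
    have hpow : u ^ (e - 1) * u = u ^ e := by rw [← pow_succ, Nat.sub_add_cancel (by omega)]
    have hcc : (C c⁻¹ : k[X]) * C c = 1 := by rw [← C_mul, inv_mul_cancel₀ hc, C_1]
    linear_combination hcc - C c⁻¹ * hpow
  have hu' : derivative u ≠ 0 := fun h => hu.ne' (derivative_eq_zero.mp h)
  have hdvd' : (u ^ e + C c) ∣ derivative u ^ 2 := by
    rw [derivative_add, derivative_C, add_zero, derivative_pow, mul_pow, mul_pow] at hdvd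
    have he0 : IsUnit (C (e : k) ^ 2) :=
      (isUnit_C.mpr (IsUnit.mk0 _ (Nat.cast_ne_zero.mpr (by omega)))).pow 2
    rw [mul_assoc, he0.dvd_mul_left] at hdvd
    exact (hcop.pow_right.pow_right).dvd_of_dvd_mul_left hdvd
  have hle := natDegree_le_of_dvd hdvd' (pow_ne_zero 2 hu')
  rw [natDegree_add_C, natDegree_pow, natDegree_pow] at hle
  have hlt := natDegree_derivative_lt hu.ne'
  nlinarith

theorem not_wordPoly_dvd_derivative_sq {c : k} (hc : c ≠ 0) {w : List ℕ}
    (hw : ∀ d ∈ w, 2 ≤ d) : ¬ wordPoly c w ∣ derivative (wordPoly c w) ^ 2 := by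
  cases w with
  | nil =>
    rw [wordPoly, derivative_X, one_pow]
    exact fun h => not_isUnit_X (isUnit_of_dvd_one h)
  | cons d w =>
    exact not_dvd_derivative_sq_of_pow_add_C
      (monic_wordPoly_and_natDegree_pos c fun e he => hw e (List.mem_cons_of_mem _ he)).2
      (hw d (by simp)) hc

theorem wordPoly_injOn {c : k} (hc : c ≠ 0) :
    Set.InjOn (wordPoly c) {w | ∀ d ∈ w, 2 ≤ d} := by
  intro v hv w hw h
  simp only [Set.mem_ofPred_eq] at hv hw
  induction v generalizing w with
  | nil =>
    cases w with
    | nil => rfl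
    | cons b w =>
      have := two_le_natDegree_wordPoly_cons c hw
      rw [← h, wordPoly, natDegree_X] at this
      omega
  | cons a v ih =>
    cases w with
    | nil =>
      have := two_le_natDegree_wordPoly_cons c hv
      rw [h, wordPoly, natDegree_X] at this
      omega
    | cons b w =>
      have hv' : ∀ d ∈ v, 2 ≤ d := fun e he => hv e (List.mem_cons_of_mem _ he)
      have hw' : ∀ d ∈ w, 2 ≤ d := fun e he => hw e (List.mem_cons_of_mem _ he)
      have ha : 2 ≤ a := hv a (by simp)
      have hb : 2 ≤ b := hw b (by simp)
      have hmv := (monic_wordPoly_and_natDegree_pos c hv').1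
      have hmw := (monic_wordPoly_and_natDegree_pos c hw').1
      have hpow : wordPoly c v ^ a = wordPoly c w ^ b := add_right_cancel h
      rcases lt_trichotomy a b with hab | rfl | hab
      · exact absurd (dvd_derivative_sq_of_pow_eq_pow (by omega) hab hmv.ne_zero hpow)
          (not_wordPoly_dvd_derivative_sq hc hv')
      -- Equal `a`-th powers agree only up to a unit, which monicity removes.
      · have hassoc : Associated (wordPoly c v) (wordPoly c w) := by
          refine associated_of_dvd_dvd ?_ ?_ <;>
            rw [← IsIntegrallyClosed.pow_dvd_pow_iff (n := a) (by omega), hpow]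
        rw [ih hv' hw' (eq_of_monic_of_associated hmv hmw hassoc)]
      · exact absurd (dvd_derivative_sq_of_pow_eq_pow (by omega) hab hmw.ne_zero hpow.symm)
          (not_wordPoly_dvd_derivative_sq hc hw')

end Polynomials

/-! ### Words as maps, and freeness -/

section Words

variable {k : Type*} [Field k]

/-- The composition of the maps `z ^ d + c`, for `d` running through a word. -/
def wordEnd (c : k) (w : List ℕ) : Function.End (P1 k) :=
  (w.map fun d => unicritical d c).prod

theorem wordEnd_cons (c : k) (d : ℕ) (w : List ℕ) (P : P1 k) :
    wordEnd c (d :: w) P = unicritical d c (wordEnd c w P) := by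
  rw [wordEnd, List.map_cons, List.prod_cons]
  rfl

theorem wordEnd_affinePt (c : k) (w : List ℕ) (t : k) :
    wordEnd c w (affinePt t) = affinePt ((wordPoly c w).eval t) := by
  induction w with
  | nil => simp [wordEnd, wordPoly, Function.End.one_def]
  | cons d w ih => rw [wordEnd_cons, ih, unicritical_affinePt, wordPoly]; simp

theorem wordEnd_injOn [CharZero k] {c : k} (hc : c ≠ 0) :
    Set.InjOn (wordEnd c) {w | ∀ d ∈ w, 2 ≤ d} := by
  intro v hv w hw h
  refine wordPoly_injOn hc hv hw (Polynomial.funext fun t => affinePt_injective ?_)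
  rw [← wordEnd_affinePt, ← wordEnd_affinePt, h]

end Words

theorem generatesFreely_unicriticalSet (𝔡 : Set ℕ) {c : Qbar} (hc : c ≠ 0) :
    GeneratesFreely (unicriticalSet 𝔡 c) := by
  choose D hD using fun φ : unicriticalSet 𝔡 c => φ.2
  have hlift : ∀ l : FreeMonoid (unicriticalSet 𝔡 c),
      FreeMonoid.lift (fun φ : unicriticalSet 𝔡 c => (φ : Function.End (P1 Qbar))) l =
        wordEnd c (l.toList.map D) := by
    intro l
    rw [FreeMonoid.lift_apply, wordEnd, List.map_map]
    congr 1
    exact List.map_congr_left fun φ _ => (hD φ).2.2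
  have hmem : ∀ l : FreeMonoid (unicriticalSet 𝔡 c), ∀ d ∈ l.toList.map D, 2 ≤ d := by
    intro l d hd
    obtain ⟨φ, -, rfl⟩ := List.mem_map.mp hd
    exact (hD φ).2.1
  have hinj : Function.Injective D := fun φ ψ h =>
    Subtype.ext ((hD φ).2.2.trans ((congrArg (unicritical · c) h).trans (hD ψ).2.2.symm))
  intro v w h
  rw [hlift, hlift] at h
  exact FreeMonoid.toList.injective
    (hinj.list_map (wordEnd_injOn hc (hmem v) (hmem w) h))

theorem mem_genMonoid_unicriticalSet_iff {𝔡 : Set ℕ} {c : Qbar} {f : Function.End (P1 Qbar)} :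
    f ∈ genMonoid (unicriticalSet 𝔡 c) ↔ ∃ w : List ℕ, (∀ d ∈ w, d ∈ 𝔡 ∧ 2 ≤ d) ∧
      wordEnd c w = f := by
  constructor
  · intro hf
    induction hf using Submonoid.closure_induction_left with
    | one => exact ⟨[], by simp, rfl⟩
    | mul_left φ hφ g _ ih =>
      obtain ⟨w, hw, rfl⟩ := ih
      obtain ⟨d, hd, hd2, rfl⟩ := hφ
      refine ⟨d :: w, ?_, ?_⟩
      · simpa [hd, hd2] using hw
      · rw [wordEnd, List.map_cons, List.prod_cons]
        rfl
  · rintro ⟨w, hw, rfl⟩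
    refine Submonoid.list_prod_mem _ fun φ hφ => ?_
    obtain ⟨d, hd, rfl⟩ := List.mem_map.mp hφ
    exact Submonoid.subset_closure ⟨d, (hw d hd).1, (hw d hd).2, rfl⟩

theorem one_le_prod_of_two_le {w : List ℕ} (hw : ∀ d ∈ w, 2 ≤ d) : 1 ≤ w.prod :=
  Nat.one_le_iff_ne_zero.mpr (List.prod_ne_zero fun h => by simpa using hw 0 h)

/-- The factor `n - 1` instead of `n` lets the induction close: `A + d A (n - 1) ≤ A (d n - 1)`
because `d ≥ 2`. -/
theorem abs_logHeight_wordEnd_sub_le (c : Qbar) {w : List ℕ} (hw : ∀ d ∈ w, 2 ≤ d)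
    (P : P1 Qbar) :
    |logHeight (wordEnd c w P) - w.prod * logHeight P| ≤
      (Real.log 2 + NumberField.absLogHeight₁ c) * (w.prod - 1) := by
  induction w with
  | nil => simp [wordEnd, Function.End.one_def]
  | cons d w ih =>
    have hd : 2 ≤ d := hw d (by simp)
    have h1 := abs_logHeight_unicritical_sub_le (d := d) (by omega) c (wordEnd c w P)
    have h2 := ih fun e he => hw e (List.mem_cons_of_mem _ he)
    set A := Real.log 2 + NumberField.absLogHeight₁ c
    have hA : 0 ≤ A := (abs_nonneg _).trans h1
    have hd' : (2 : ℝ) ≤ d := by exact_mod_cast hd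
    rw [wordEnd_cons, List.prod_cons, Nat.cast_mul]
    calc |logHeight (unicritical d c (wordEnd c w P)) - d * w.prod * logHeight P|
        = |(logHeight (unicritical d c (wordEnd c w P)) - d * logHeight (wordEnd c w P)) +
            d * (logHeight (wordEnd c w P) - w.prod * logHeight P)| := by ring_nf
      _ ≤ A + d * (A * (w.prod - 1)) := by
          refine (abs_add_le _ _).trans (add_le_add h1 ?_)
          rw [abs_mul, Nat.abs_cast]
          gcongr
      _ ≤ A * (d * w.prod - 1) := by nlinarith

theorem heightControlledLogDiscrete_unicriticalSet {𝔡 : Set ℕ} (h𝔡 : UniformlyLogDiscrete 𝔡)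
    (c : Qbar) : HeightControlledLogDiscrete (unicriticalSet 𝔡 c) := by
  classical
  let D : Function.End (P1 Qbar) → ℕ := fun φ =>
    if h : φ ∈ unicriticalSet 𝔡 c then h.choose else 0
  have hD : ∀ φ ∈ unicriticalSet 𝔡 c, D φ ∈ 𝔡 ∧ 2 ≤ D φ ∧ φ = unicritical (D φ) c := by
    intro φ h
    simp only [D, dif_pos h]
    exact h.choose_spec
  refine ⟨fun φ => D φ, ⟨fun φ hφ => ⟨?_, ?_⟩, ?_⟩, ?_⟩
  · exact Nat.one_lt_cast.mpr (hD φ hφ).2.1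
  · obtain ⟨-, -, h⟩ := hD φ hφ
    conv => arg 1; rw [h]
    exact isPullback_unicritical c
  · refine ⟨Real.log 2 + NumberField.absLogHeight₁ c, fun φ hφ P => ?_⟩
    obtain ⟨-, h2, h⟩ := hD φ hφ
    conv => lhs; arg 1; arg 1; rw [h]
    exact abs_logHeight_unicritical_sub_le (by omega) c P
  · obtain ⟨δ, hδ, h⟩ := h𝔡
    refine ⟨δ, hδ, fun φ hφ ψ hψ hne => h _ (hD φ hφ).1 _ (hD ψ hψ).1 fun heq => hne ?_⟩
    rw [(hD φ hφ).2.2, (hD ψ hψ).2.2, heq]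

/-! ### Counting words by the product of their letters -/

section Counting

/-- The words with letters in `D` whose product is at most `x`. -/
def wordsLE (D : Set ℕ) (x : ℝ) : Set (List ℕ) :=
  {w | (∀ d ∈ w, d ∈ D) ∧ (w.prod : ℝ) ≤ x}

variable {D : Set ℕ}

theorem wordsLE_eq_empty (hD : ∀ d ∈ D, 2 ≤ d) {x : ℝ} (hx : x < 1) : wordsLE D x = ∅ := by
  refine Set.eq_empty_of_forall_notMem fun w hw => ?_
  have h1 : (1 : ℝ) ≤ w.prod := by
    exact_mod_cast one_le_prod_of_two_le fun d hd => hD d (hw.1 d hd)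
  linarith [hw.2]

theorem cons_mem_wordsLE_iff {d : ℕ} (hd : d ≠ 0) {w : List ℕ} {x : ℝ} :
    d :: w ∈ wordsLE D x ↔ d ∈ D ∧ w ∈ wordsLE D (x / d) := by
  have hd' : (0 : ℝ) < d := by positivity
  simp only [wordsLE, Set.mem_ofPred_eq, List.mem_cons, forall_eq_or_imp, List.prod_cons,
    Nat.cast_mul, le_div_iff₀ hd', and_assoc, mul_comm (d : ℝ)]

open Classical in
/-- The elements of `D` that are at most `x`. -/
def lettersLE (D : Set ℕ) (x : ℝ) : Finset ℕ := {d ∈ Finset.range (⌊x⌋₊ + 1) | d ∈ D}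

theorem mem_of_mem_lettersLE {x : ℝ} {d : ℕ} (hd : d ∈ lettersLE D x) : d ∈ D := by
  classical
  exact (Finset.mem_filter.mp hd).2

theorem wordsLE_subset (hD : ∀ d ∈ D, 2 ≤ d) (x : ℝ) :
    wordsLE D x ⊆ {[]} ∪ ⋃ d ∈ lettersLE D x, List.cons d '' wordsLE D (x / d) := by
  rintro (_ | ⟨d, w⟩) hw
  · simp
  · have hd0 : d ≠ 0 := by
      have := hD d (hw.1 d (by simp))
      omega
    obtain ⟨hd, hw'⟩ := (cons_mem_wordsLE_iff hd0).mp hw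
    refine Or.inr (Set.mem_biUnion (x := d) ?_ ⟨w, hw', rfl⟩)
    have h1 : 1 ≤ w.prod := one_le_prod_of_two_le fun e he => hD e (hw'.1 e he)
    have hle : (d : ℝ) ≤ x := by
      refine le_trans ?_ hw.2
      rw [List.prod_cons]
      exact_mod_cast Nat.le_mul_of_pos_right d h1
    have := Nat.le_floor hle
    simp only [lettersLE, Finset.coe_filter, Finset.mem_range, Set.mem_ofPred_eq]
    exact ⟨by omega, hd⟩

/-- Induction on a real number along division by numbers that are at least `2`. -/
theorem real_induction_div {p : ℝ → Prop}
    (h : ∀ x, (∀ d : ℕ, 2 ≤ d → 1 ≤ x → p (x / d)) → p x) (x : ℝ) : p x := by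
  obtain ⟨n, hn⟩ := pow_unbounded_of_one_lt x (one_lt_two : (1 : ℝ) < 2)
  induction n generalizing x with
  | zero => exact h x fun d _ hx => absurd hn (by simpa using hx)
  | succ n ih =>
    refine h x fun d hd hx => ih _ ?_
    have hd' : (2 : ℝ) ≤ d := by exact_mod_cast hd
    rw [div_lt_iff₀ (by linarith)]
    rw [pow_succ] at hn
    have : (0 : ℝ) < 2 ^ n := by positivity
    nlinarith

theorem finite_wordsLE (hD : ∀ d ∈ D, 2 ≤ d) (x : ℝ) : (wordsLE D x).Finite := by
  induction x using real_induction_div with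
  | h x ih =>
    rcases lt_or_ge x 1 with hx | hx
    · rw [wordsLE_eq_empty hD hx]
      exact Set.finite_empty
    · refine Set.Finite.subset ?_ (wordsLE_subset hD x)
      refine (Set.finite_singleton _).union (Set.Finite.biUnion (Finset.finite_toSet _) ?_)
      intro d hd
      exact (ih d (hD d (mem_of_mem_lettersLE hd)) hx).image _

/-- Upper half of the recursion on the first letter; the `1` counts the empty word. -/
theorem ncard_wordsLE_le (hD : ∀ d ∈ D, 2 ≤ d) (x : ℝ) :
    (wordsLE D x).ncard ≤ 1 + ∑ d ∈ lettersLE D x, (wordsLE D (x / d)).ncard := by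
  have hfin : (⋃ d ∈ lettersLE D x, List.cons d '' wordsLE D (x / d)).Finite :=
    Set.Finite.biUnion (Finset.finite_toSet _) fun d _ => (finite_wordsLE hD _).image _
  calc (wordsLE D x).ncard
      ≤ ({[]} ∪ ⋃ d ∈ lettersLE D x, List.cons d '' wordsLE D (x / d)).ncard :=
        Set.ncard_le_ncard (wordsLE_subset hD x) ((Set.finite_singleton _).union hfin)
    _ ≤ 1 + (⋃ d ∈ lettersLE D x, List.cons d '' wordsLE D (x / d)).ncard := by
        refine (Set.ncard_union_le _ _).trans ?_
        rw [Set.ncard_singleton]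
    _ ≤ 1 + ∑ d ∈ lettersLE D x, (List.cons d '' wordsLE D (x / d)).ncard := by
        gcongr
        exact Finset.set_ncard_biUnion_le _ _
    _ = 1 + ∑ d ∈ lettersLE D x, (wordsLE D (x / d)).ncard := by
        congr 1
        exact Finset.sum_congr rfl fun d _ =>
          Set.ncard_image_of_injective _ List.cons_injective

/-- Lower half of the recursion: words with different first letters are distinct. -/
theorem sum_ncard_wordsLE_le (hD : ∀ d ∈ D, 2 ≤ d) {F : Finset ℕ} (hF : ∀ d ∈ F, d ∈ D) (x : ℝ) :
    ∑ d ∈ F, (wordsLE D (x / d)).ncard ≤ (wordsLE D x).ncard := by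
  classical
  have hcard : ∀ d : ℕ, (wordsLE D (x / d)).ncard =
      ((finite_wordsLE hD (x / d)).toFinset.image (List.cons d)).card := fun d => by
    rw [Finset.card_image_of_injective _ List.cons_injective,
      Set.ncard_eq_toFinset_card _ (finite_wordsLE hD (x / d))]
  rw [Finset.sum_congr rfl fun d _ => hcard d, ← Finset.card_biUnion,
    Set.ncard_eq_toFinset_card _ (finite_wordsLE hD x)]
  · refine Finset.card_le_card fun w hw => ?_
    simp only [Finset.mem_biUnion, Finset.mem_image, Set.Finite.mem_toFinset] at hw ⊢
    obtain ⟨d, hd, v, hv, rfl⟩ := hw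
    have := hD d (hF d hd)
    exact (cons_mem_wordsLE_iff (by omega)).mpr ⟨hF d hd, hv⟩
  · intro d _ e _ hde
    rw [Function.onFun, Finset.disjoint_left]
    intro w hd he
    obtain ⟨v, -, rfl⟩ := Finset.mem_image.mp hd
    obtain ⟨v', -, h⟩ := Finset.mem_image.mp he
    exact hde (List.cons.inj h).1.symm

/-- The constant solves `1 + C q = C`, and the empty word is absorbed by `1 ≤ x ^ s`. -/
theorem ncard_wordsLE_le_rpow (hD : ∀ d ∈ D, 2 ≤ d) {s q : ℝ} (hs : 0 ≤ s) (hq : q < 1)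
    (hsum : ∀ F : Finset ℕ, (∀ d ∈ F, d ∈ D) → ∑ d ∈ F, (d : ℝ) ^ (-s) ≤ q) {x : ℝ} (hx : 0 ≤ x) :
    ((wordsLE D x).ncard : ℝ) ≤ (1 - q)⁻¹ * x ^ s := by
  have hq' : 0 < 1 - q := by linarith
  induction x using real_induction_div with
  | h x ih =>
    rcases lt_or_ge x 1 with hx1 | hx1
    · rw [wordsLE_eq_empty hD hx1]
      simp only [Set.ncard_empty, Nat.cast_zero]
      positivity
    · have hmem : ∀ d ∈ lettersLE D x, d ∈ D := fun d hd => mem_of_mem_lettersLE hd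
      calc ((wordsLE D x).ncard : ℝ)
          ≤ 1 + ∑ d ∈ lettersLE D x, ((wordsLE D (x / d)).ncard : ℝ) := by
            exact_mod_cast ncard_wordsLE_le hD x
        _ ≤ 1 + ∑ d ∈ lettersLE D x, (1 - q)⁻¹ * x ^ s * (d : ℝ) ^ (-s) := by
            gcongr with d hd
            refine (ih d (hD d (hmem d hd)) hx1 (by positivity)).trans_eq ?_
            rw [Real.div_rpow hx (by positivity), Real.rpow_neg (by positivity), mul_assoc,
              div_eq_mul_inv]
        _ = 1 + (1 - q)⁻¹ * x ^ s * ∑ d ∈ lettersLE D x, (d : ℝ) ^ (-s) := by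
            rw [Finset.mul_sum]
        _ ≤ x ^ s + (1 - q)⁻¹ * x ^ s * q := by
            gcongr
            · exact Real.one_le_rpow hx1 hs
            · exact hsum _ hmem
        _ = (1 - q)⁻¹ * x ^ s := by
            field_simp
            ring

/-- Up to `m` the empty word suffices, since `m ^ (-b) x ^ b ≤ 1`; beyond `m` every `x / d` is at
least `1` and the recursion propagates the bound. -/
theorem rpow_le_ncard_wordsLE (hD : ∀ d ∈ D, 2 ≤ d) {b : ℝ} (hb : 0 ≤ b) {F : Finset ℕ}
    (hF : ∀ d ∈ F, d ∈ D) (hsum : 1 ≤ ∑ d ∈ F, (d : ℝ) ^ (-b)) {m : ℝ} (hm : 0 < m)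
    (hmF : ∀ d ∈ F, (d : ℝ) ≤ m) {x : ℝ} (hx : 1 ≤ x) :
    m ^ (-b) * x ^ b ≤ ((wordsLE D x).ncard : ℝ) := by
  induction x using real_induction_div with
  | h x ih =>
    rcases le_or_gt x m with hxm | hxm
    · have h1 : 1 ≤ (wordsLE D x).ncard := by
        rw [Nat.one_le_iff_ne_zero, Ne, Set.ncard_eq_zero (finite_wordsLE hD x)]
        exact Set.Nonempty.ne_empty ⟨[], by simp, by simpa using hx⟩
      calc m ^ (-b) * x ^ b ≤ m ^ (-b) * m ^ b := by gcongr
        _ = 1 := by rw [← Real.rpow_add hm, neg_add_cancel, Real.rpow_zero]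
        _ ≤ _ := by exact_mod_cast h1
    · calc m ^ (-b) * x ^ b ≤ m ^ (-b) * x ^ b * ∑ d ∈ F, (d : ℝ) ^ (-b) :=
            le_mul_of_one_le_right (by positivity) hsum
        _ = ∑ d ∈ F, m ^ (-b) * (x / d) ^ b := by
            rw [Finset.mul_sum]
            refine Finset.sum_congr rfl fun d _ => ?_
            rw [Real.div_rpow (by linarith) (by positivity), Real.rpow_neg d.cast_nonneg,
              mul_assoc, div_eq_mul_inv]
        _ ≤ ∑ d ∈ F, ((wordsLE D (x / d)).ncard : ℝ) := by
            gcongr with d hd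
            have hd2 := hD d (hF d hd)
            have hd0 : (0 : ℝ) < d := by positivity
            refine ih d hd2 hx ?_
            rw [one_le_div hd0]
            exact (hmF d hd).trans hxm.le
        _ ≤ _ := by exact_mod_cast sum_ncard_wordsLE_le hD hF x

theorem sum_Ico_two_rpow_neg_two_le (n : ℕ) :
    ∑ d ∈ Finset.Ico 2 (n + 2), (d : ℝ) ^ (-2 : ℝ) ≤ 1 - 1 / (n + 1) := by
  induction n with
  | zero => simp
  | succ n ih =>
    rw [show n + 1 + 2 = (n + 2) + 1 by ring, Finset.sum_Ico_succ_top (by omega)]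
    -- Telescoping comparison.
    have h : ((n + 2 : ℕ) : ℝ) ^ (-2 : ℝ) ≤ 1 / (n + 1) - 1 / ((n + 1 : ℕ) + 1) := by
      rw [Real.rpow_neg (by positivity), Real.rpow_two]
      push_cast
      rw [div_sub_div _ _ (by positivity) (by positivity), inv_eq_one_div,
        div_le_div_iff₀ (by positivity) (by positivity)]
      nlinarith [(n.cast_nonneg : (0 : ℝ) ≤ n)]
    linarith

theorem sum_rpow_neg_two_lt_one {F : Finset ℕ} (hF : ∀ d ∈ F, 2 ≤ d) :
    ∑ d ∈ F, (d : ℝ) ^ (-2 : ℝ) < 1 := by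
  have hsub : F ⊆ Finset.Ico 2 (F.sup id + 2) := fun d hd => by
    have : d ≤ F.sup id := Finset.le_sup (f := id) hd
    have := hF d hd
    rw [Finset.mem_Ico]
    omega
  refine (Finset.sum_le_sum_of_subset_of_nonneg hsub fun _ _ _ => by positivity).trans_lt ?_
  refine (sum_Ico_two_rpow_neg_two_le _).trans_lt ?_
  have : (0 : ℝ) < 1 / ((F.sup id : ℕ) + 1) := by positivity
  linarith

/-- The exponents at which some finite sum reaches `1` form a set bounded by `2`. Take `b` in it
within `ε / 2` of its supremum: for infinite `D` the supremum itself need not be attained by a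
finite sum. -/
theorem exists_exponent (hD : ∀ d ∈ D, 2 ≤ d) (hnt : D.Nontrivial) {ε : ℝ} (hε : 0 < ε) :
    ∃ b : ℝ, 0 < b ∧
      (∃ F : Finset ℕ, (∀ d ∈ F, d ∈ D) ∧ 1 ≤ ∑ d ∈ F, (d : ℝ) ^ (-b)) ∧
      ∃ q : ℝ, q < 1 ∧
        ∀ F : Finset ℕ, (∀ d ∈ F, d ∈ D) → ∑ d ∈ F, (d : ℝ) ^ (-(b + ε)) ≤ q := by
  let A : Set ℝ :=
    {b | 0 < b ∧ ∃ F : Finset ℕ, (∀ d ∈ F, d ∈ D) ∧ 1 ≤ ∑ d ∈ F, (d : ℝ) ^ (-b)}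
  have hne : A.Nonempty := by
    obtain ⟨d, hd, e, he, hde⟩ := hnt
    set m : ℝ := max d e with hm
    have hd2 : (2 : ℝ) ≤ d := by exact_mod_cast hD d hd
    have he2 : (2 : ℝ) ≤ e := by exact_mod_cast hD e he
    have hm2 : 2 ≤ m := hd2.trans (le_max_left _ _)
    -- At exponent `log_m 2` each of the two letters contributes at least `1 / 2`.
    have hb : 0 < Real.logb m 2 := Real.logb_pos (by linarith) (by norm_num)
    have hle : ∀ x : ℝ, 2 ≤ x → x ≤ m → 1 / 2 ≤ x ^ (-Real.logb m 2) := by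
      intro x hx hxm
      calc (1 : ℝ) / 2 = m ^ (-Real.logb m 2) := by
            rw [Real.rpow_neg (by linarith),
              Real.rpow_logb (by linarith) (by linarith) (by norm_num), one_div]
        _ ≤ x ^ (-Real.logb m 2) :=
            Real.rpow_le_rpow_of_nonpos (by linarith) hxm (by linarith)
    refine ⟨Real.logb m 2, hb, {d, e}, by simp [hd, he], ?_⟩
    rw [Finset.sum_pair hde]
    linarith [hle d hd2 (le_max_left _ _), hle e he2 (le_max_right _ _)]
  have hbdd : BddAbove A := by
    refine ⟨2, fun b hb => ?_⟩
    obtain ⟨-, F, hF, hsum⟩ := hb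
    by_contra! hlt
    refine absurd (hsum.trans (Finset.sum_le_sum fun d hd => ?_))
      (sum_rpow_neg_two_lt_one fun d hd => hD d (hF d hd)).not_ge
    have hd2 : (2 : ℝ) ≤ d := by exact_mod_cast hD d (hF d hd)
    exact Real.rpow_le_rpow_of_exponent_le (by linarith) (by linarith)
  obtain ⟨b, hbA, hlt⟩ := exists_lt_of_lt_csSup hne (show sSup A - ε / 2 < sSup A by linarith)
  refine ⟨b, hbA.1, hbA.2, (2 : ℝ) ^ (-(ε / 2)),
    Real.rpow_lt_one_of_one_lt_of_neg (by norm_num) (by linarith), fun F hF => ?_⟩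
  -- Past the supremum finite sums are below `1`; the remaining `ε / 2` gains the uniform factor `2
  -- ^ (-ε / 2)`, as all letters are at least `2`.
  have hnot : b + ε / 2 ∉ A := fun h => by linarith [le_csSup hbdd h]
  have hlt1 : ∑ d ∈ F, (d : ℝ) ^ (-(b + ε / 2)) < 1 := by
    by_contra! h
    exact hnot ⟨by linarith [hbA.1], F, hF, h⟩
  calc ∑ d ∈ F, (d : ℝ) ^ (-(b + ε))
      ≤ ∑ d ∈ F, (d : ℝ) ^ (-(b + ε / 2)) * (2 : ℝ) ^ (-(ε / 2)) := by
        refine Finset.sum_le_sum fun d hd => ?_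
        have hd2 : (2 : ℝ) ≤ d := by exact_mod_cast hD d (hF d hd)
        rw [show -(b + ε) = -(b + ε / 2) + -(ε / 2) by ring, Real.rpow_add (by linarith)]
        gcongr ?_ * ?_
        exact Real.rpow_le_rpow_of_nonpos (by norm_num) hd2 (by linarith)
    _ = (∑ d ∈ F, (d : ℝ) ^ (-(b + ε / 2))) * (2 : ℝ) ^ (-(ε / 2)) := by rw [Finset.sum_mul]
    _ ≤ 1 * (2 : ℝ) ^ (-(ε / 2)) := by gcongr
    _ = _ := one_mul _

end Counting

/-! ### From words to the function count -/

theorem functionCount_unicriticalSet {𝔡 : Set ℕ} {c : Qbar} (hc : c ≠ 0)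
    (hnt : (unicriticalSet 𝔡 c).Nontrivial) : FunctionCount (unicriticalSet 𝔡 c) := by
  set D : Set ℕ := {d | d ∈ 𝔡 ∧ 2 ≤ d} with hDdef
  have hD : ∀ d ∈ D, 2 ≤ d := fun d hd => hd.2
  have hDnt : D.Nontrivial := by
    obtain ⟨φ, ⟨d, hd, hd2, rfl⟩, ψ, ⟨e, he, he2, rfl⟩, hne⟩ := hnt
    exact ⟨d, ⟨hd, hd2⟩, e, ⟨he, he2⟩, fun h => hne (by rw [h])⟩
  set A : ℝ := Real.log 2 + NumberField.absLogHeight₁ c with hA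
  have hA0 : 0 ≤ A := (abs_nonneg _).trans
    (abs_logHeight_unicritical_sub_le one_ne_zero c (inftyPt Qbar))
  refine ⟨Real.exp A, fun ε hε => ?_⟩
  obtain ⟨b, hb, ⟨F, hF, hFsum⟩, q, hq, hqsum⟩ := exists_exponent hD hDnt hε
  refine ⟨b, hb, fun P hP => ?_⟩
  have hh : A < logHeight P := by
    rw [logHeight, Real.lt_log_iff_exp_lt (by linarith [one_le_mulHeight P])]
    exact hP
  set h := logHeight P with hhdef
  set m : ℝ := (F.sup id : ℕ) + 1 with hm
  have hm0 : 0 < m := by positivity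
  have hmF : ∀ d ∈ F, (d : ℝ) ≤ m := fun d hd => by
    have : d ≤ F.sup id := Finset.le_sup (f := id) hd
    have : (d : ℝ) ≤ (F.sup id : ℕ) := by exact_mod_cast this
    linarith
  have hsub : 0 < h - A := by linarith
  have hadd : 0 < h + A := by linarith
  have hq' : 0 < 1 - q := by linarith
  refine ⟨m ^ (-b) * ((h + A) ^ b)⁻¹, (1 - q)⁻¹ * ((h - A) ^ (b + ε))⁻¹, by positivity,
    by positivity, ?_⟩
  -- `log B ≥ h + A` puts `log B / (h + A)` in the range `x ≥ 1` of the lower count.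
  filter_upwards [Filter.eventually_gt_atTop 0,
    Real.tendsto_log_atTop.eventually_ge_atTop (h + A)] with B hB hlogB
  have hlog0 : 0 ≤ Real.log B := hadd.le.trans hlogB
  set T : Set (List ℕ) := {w | (∀ d ∈ w, d ∈ D) ∧ mulHeight (wordEnd c w P) ≤ B} with hT
  have himage : {f | f ∈ genMonoid (unicriticalSet 𝔡 c) ∧ mulHeight (f P) ≤ B} =
      wordEnd c '' T := by
    ext f
    simp only [Set.mem_ofPred_eq, mem_genMonoid_unicriticalSet_iff, Set.mem_image, hT]
    constructor
    · rintro ⟨⟨w, hw, rfl⟩, hle⟩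
      exact ⟨w, ⟨hw, hle⟩, rfl⟩
    · rintro ⟨w, ⟨hw, hle⟩, rfl⟩
      exact ⟨⟨w, hw, rfl⟩, hle⟩
  have hiff : ∀ w, mulHeight (wordEnd c w P) ≤ B ↔ logHeight (wordEnd c w P) ≤ Real.log B :=
    fun w => (Real.log_le_log_iff (by linarith [one_le_mulHeight (wordEnd c w P)]) hB).symm
  -- Here `h(f P) ≤ n h + A (n - 1) ≤ n (h + A)`; for the other inclusion, `n (h - A) ≤ h(f P)`.
  have hlower : wordsLE D (Real.log B / (h + A)) ⊆ T := by
    rintro w ⟨hw, hle⟩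
    refine ⟨hw, (hiff w).mpr ?_⟩
    have := (abs_le.mp (abs_logHeight_wordEnd_sub_le c (fun d hd => hD d (hw d hd)) P)).2
    rw [le_div_iff₀ hadd] at hle
    nlinarith
  have hupper : T ⊆ wordsLE D (Real.log B / (h - A)) := by
    rintro w ⟨hw, hle⟩
    refine ⟨hw, ?_⟩
    have := (abs_le.mp (abs_logHeight_wordEnd_sub_le c (fun d hd => hD d (hw d hd)) P)).1
    rw [hiff] at hle
    rw [le_div_iff₀ hsub]
    nlinarith
  have hfin := finite_wordsLE hD (Real.log B / (h - A))
  have hTfin : T.Finite := hfin.subset hupper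
  have hTsub : T ⊆ {w | ∀ d ∈ w, 2 ≤ d} := fun w hw d hd => hD d (hw.1 d hd)
  have hncard : (wordEnd c '' T).ncard = T.ncard :=
    ((wordEnd_injOn hc).mono hTsub).ncard_image
  rw [himage, hncard]
  refine ⟨hTfin.image _, ?_, ?_⟩
  · calc m ^ (-b) * ((h + A) ^ b)⁻¹ * Real.log B ^ b
        = m ^ (-b) * (Real.log B / (h + A)) ^ b := by
          rw [Real.div_rpow hlog0 hadd.le, div_eq_inv_mul, mul_assoc]
      _ ≤ (wordsLE D (Real.log B / (h + A))).ncard :=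
          rpow_le_ncard_wordsLE hD hb.le hF hFsum hm0 hmF ((one_le_div hadd).mpr hlogB)
      _ ≤ T.ncard := by exact_mod_cast Set.ncard_le_ncard hlower hTfin
  · calc (T.ncard : ℝ) ≤ (wordsLE D (Real.log B / (h - A))).ncard := by
          exact_mod_cast Set.ncard_le_ncard hupper hfin
      _ ≤ (1 - q)⁻¹ * (Real.log B / (h - A)) ^ (b + ε) :=
          ncard_wordsLE_le_rpow hD (by linarith) hq hqsum (by positivity)
      _ = (1 - q)⁻¹ * ((h - A) ^ (b + ε))⁻¹ * Real.log B ^ (b + ε) := by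
          rw [Real.div_rpow hlog0 hsub.le, div_eq_inv_mul, mul_assoc]

end OrbitCount

end

theorem corollary3p3 (𝔡 : Set ℕ) (h𝔡 : OrbitCount.UniformlyLogDiscrete 𝔡)
    (c : OrbitCount.Qbar) (hc : c ≠ 0) :
    OrbitCount.HeightControlledLogDiscrete (OrbitCount.unicriticalSet 𝔡 c) ∧
    OrbitCount.GeneratesFreely (OrbitCount.unicriticalSet 𝔡 c) ∧
    ((OrbitCount.unicriticalSet 𝔡 c).Nontrivial →
      OrbitCount.FunctionCount (OrbitCount.unicriticalSet 𝔡 c)) :=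
  ⟨OrbitCount.heightControlledLogDiscrete_unicriticalSet h𝔡 c,
    OrbitCount.generatesFreely_unicriticalSet 𝔡 hc,
    OrbitCount.functionCount_unicriticalSet hc⟩
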